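/- Let $\kappa$ be a regular cardinal and let $\mathcal X$ be a locally $\kappa$-presentable category. Consider the fibration of endofunctor algebras restricted to the $\kappa$-accessible endofunctors of $\mathcal X$ (those preserving $\kappa$-filtered colimits): its base is the full subcategory of the category of endofunctors of $\mathcal X$ on the $\kappa$-accessible ones, its fibre over $F$ is the category $\mathrm{Alg}(F)$ of pairs $(X,\ \xi: FX\to X)$ with algebra homomorphisms, and the reindexing along a natural transformation $\alpha: F\Rightarrow G$ is the functor $$\alpha^* : \mathrm{Alg}(G)\to \mathrm{Alg}(F),\qquad (Y,\ \zeta: GY\to Y)\mapsto (Y,\ \zeta\circ\alpha_Y : FY\to Y),$$ which acts as the identity on underlying morphisms. Then for all $\kappa$-accessible endofunctors $F,G$ of $\mathcal X$ and every natural transformation $\alpha: F\Rightarrow G$, the reindexing functor $\alpha^*$ has a left adjoint $\mathrm{Alg}(F)\to\mathrm{Alg}(G)$. -/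

import Mathlib

open CategoryTheory

universe w v u

theorem algebra_hom_heq {X : Type u} [Category.{v} X] {F : X ⥤ X}
    {A A' B B' : Endofunctor.Algebra F} (hA : A = A') (hB : B = B') {f : A ⟶ B} {g : A' ⟶ B'}
    (h : HEq f.f g.f) : HEq f g := by
  subst hA hB
  exact heq_of_eq (Endofunctor.Algebra.ext (eq_of_heq h))

theorem algebra_mk_congr {X : Type u} [Category.{v} X] {F : X ⥤ X} {a : X}
    {s t : F.obj a ⟶ a} (h : s = t) :
    (⟨a, s⟩ : Endofunctor.Algebra F) = ⟨a, t⟩ := by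
  subst h; rfl

theorem functorOfNatTrans_id {X : Type u} [Category.{v} X] (F : X ⥤ X) :
    Endofunctor.Algebra.functorOfNatTrans (𝟙 F) = 𝟭 (Endofunctor.Algebra F) := by
  have ho (A : Endofunctor.Algebra F) := algebra_mk_congr (Category.id_comp A.str)
  exact CategoryTheory.Functor.hext ho
    (fun A B f => algebra_hom_heq (ho A) (ho B) HEq.rfl)

theorem functorOfNatTrans_comp {X : Type u} [Category.{v} X] {F G H : X ⥤ X}
    (α : F ⟶ G) (β : G ⟶ H) :
    Endofunctor.Algebra.functorOfNatTrans (α ≫ β) =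
      Endofunctor.Algebra.functorOfNatTrans β ⋙ Endofunctor.Algebra.functorOfNatTrans α := by
  have ho (A : Endofunctor.Algebra H) :=
    algebra_mk_congr (Category.assoc (α.app A.a) (β.app A.a) A.str)
  exact CategoryTheory.Functor.hext ho
    (fun A B f => algebra_hom_heq (ho A) (ho B) HEq.rfl)

/-- The (strict) indexed category of endofunctor algebras over the category of endofunctors
of `X`; the associated split fibration is the universal fibration of endofunctor algebras.
It sends `F` to the category `Alg(F)` of `F`-algebras and `α : F ⟶ G` to the reindexing functor
`α^* : Alg(G) ⥤ Alg(F)`, `(Y, ζ : G Y ⟶ Y) ↦ (Y, α_Y ≫ ζ)`, the identity on underlying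
morphisms. -/
def algIndexed (X : Type u) [Category.{v} X] : (X ⥤ X)ᵒᵖ ⥤ Cat.{v, max u v} where
  obj F := Cat.of (Endofunctor.Algebra F.unop)
  map α := (Endofunctor.Algebra.functorOfNatTrans α.unop).toCatHom
  map_id F := by
    ext1
    exact functorOfNatTrans_id F.unop
  map_comp α β := by
    ext1
    exact functorOfNatTrans_comp β.unop α.unop

/-- The `κ`-accessible endofunctors of `X`, i.e. those preserving `κ`-filtered colimits. -/
def accessibleEndo (X : Type u) [Category.{v} X] (κ : Cardinal.{w}) [Fact κ.IsRegular] :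
    ObjectProperty (X ⥤ X) :=
  fun F => F.IsCardinalAccessible κ

/-- The indexed category of endofunctor algebras, restricted to the full subcategory of
`κ`-accessible endofunctors of `X`. -/
def accessibleAlgIndexed (X : Type u) [Category.{v} X] (κ : Cardinal.{w}) [Fact κ.IsRegular] :
    (accessibleEndo X κ).FullSubcategoryᵒᵖ ⥤ Cat.{v, max u v} :=
  (accessibleEndo X κ).ι.op ⋙ algIndexed X

/-- The reindexing functor `α^* : Alg(G) ⥤ Alg(F)` of the restricted fibration of algebras along
a natural transformation `α : F ⟶ G` between `κ`-accessible endofunctors. -/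
def algReindexing {X : Type u} [Category.{v} X] {κ : Cardinal.{w}} [Fact κ.IsRegular]
    {F G : (accessibleEndo X κ).FullSubcategory} (α : F ⟶ G) :
    Endofunctor.Algebra G.obj ⥤ Endofunctor.Algebra F.obj :=
  ((accessibleAlgIndexed X κ).map α.op).toFunctor

theorem algReindexing_eq {X : Type u} [Category.{v} X] {κ : Cardinal.{w}} [Fact κ.IsRegular]
    {F G : (accessibleEndo X κ).FullSubcategory} (α : F ⟶ G) :
    algReindexing α = Endofunctor.Algebra.functorOfNatTrans α.hom :=
  rfl

open Limits Opposite

/-! The left adjoint should send an `F`-algebra `A` to the free `G`-algebra on the pushout of its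
structure map along `α`. That pushout is only a pre-algebra `extend α A`, whose maps to `G`-algebras
are exactly the `F`-algebra maps out of `A` (`extendEquiv`). So it suffices to reflect pre-algebras
into algebras (`isRightAdjoint_ofAlgebra`). Pre-algebras are cocomplete, and algebras are those with
invertible comparison morphism. Tested on a strong generator of `κ`-presentable objects,
invertibility is orthogonality to a small set of maps between free pre-algebras. These are
`κ`-presentable because carrier and codomain are accessible right adjoints, so the orthogonal
subcategory is reflective. -/

/-- A pre-algebra for an endofunctor `G`: a structure map `G X ⟶ Y` whose codomain is only
related to `X` by a comparison morphism `X ⟶ Y`. Algebras are the pre-algebras whose comparison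
morphism is invertible. -/
structure PreAlgebra {C : Type u} [Category.{v} C] (G : C ⥤ C) where
  /-- the carrier -/
  src : C
  /-- the codomain of the structure map -/
  tgt : C
  /-- the comparison morphism -/
  unit : src ⟶ tgt
  /-- the structure map -/
  str : G.obj src ⟶ tgt

namespace PreAlgebra

variable {C : Type u} [Category.{v} C] {G : C ⥤ C}

/-- Morphisms of pre-algebras. -/
@[ext]
structure Hom (R S : PreAlgebra G) where
  /-- the morphism on carriers -/
  src : R.src ⟶ S.src
  /-- the morphism on codomains -/
  tgt : R.tgt ⟶ S.tgt
  unit_tgt : R.unit ≫ tgt = src ≫ S.unit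
  str_tgt : R.str ≫ tgt = G.map src ≫ S.str

instance : Category (PreAlgebra G) where
  Hom := Hom
  id R := ⟨𝟙 _, 𝟙 _, by simp, by simp⟩
  comp f g := ⟨f.src ≫ g.src, f.tgt ≫ g.tgt, by
    rw [← Category.assoc, f.unit_tgt, Category.assoc, g.unit_tgt, Category.assoc], by
    rw [← Category.assoc, f.str_tgt, Category.assoc, g.str_tgt, Functor.map_comp,
      Category.assoc]⟩

@[ext]
theorem hom_ext {R S : PreAlgebra G} {f g : R ⟶ S} (h₁ : f.src = g.src) (h₂ : f.tgt = g.tgt) :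
    f = g :=
  Hom.ext h₁ h₂

variable (G) in
/-- The functor sending a pre-algebra to its carrier. -/
def srcFunctor : PreAlgebra G ⥤ C where
  obj R := R.src
  map f := f.src

variable (G) in
/-- The functor sending a pre-algebra to the codomain of its structure map. -/
def tgtFunctor : PreAlgebra G ⥤ C where
  obj R := R.tgt
  map f := f.tgt

variable (G) in
/-- The comparison morphisms form a natural transformation. -/
def unitNatTrans : srcFunctor G ⟶ tgtFunctor G where
  app R := R.unit
  naturality _ _ f := f.unit_tgt.symm

variable (G) in
/-- The structure maps form a natural transformation. -/
def strNatTrans : srcFunctor G ⋙ G ⟶ tgtFunctor G where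
  app R := R.str
  naturality _ _ f := f.str_tgt.symm

theorem locallySmall [LocallySmall.{w} C] : LocallySmall.{w} (PreAlgebra G) where
  hom_small R S := small_of_injective
    (β := (R.src ⟶ S.src) × (R.tgt ⟶ S.tgt)) (f := fun f => (f.src, f.tgt))
    (fun _ _ h => hom_ext (congrArg Prod.fst h) (congrArg Prod.snd h))

/-! ### Colimits of pre-algebras -/

section Colimits

variable {J : Type*} [Category* J] {D : J ⥤ PreAlgebra G}
  {cX : Cocone (D ⋙ srcFunctor G)} (hX : IsColimit cX)
  {cG : Cocone ((D ⋙ srcFunctor G) ⋙ G)} (hG : IsColimit cG)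
  {cY : Cocone (D ⋙ tgtFunctor G)} {Z : C} {t : G.obj cX.pt ⟶ Z} {i : cY.pt ⟶ Z}

theorem map_ι_comp
    (sq : IsPushout (hG.desc (G.mapCocone cX))
      (hG.desc ((Cocone.precompose (Functor.whiskerLeft D (strNatTrans G))).obj cY)) t i)
    (j : J) :
    G.map (Y := cX.pt) (cX.ι.app j) ≫ t =
      (D.obj j).str ≫ (show (D.obj j).tgt ⟶ cY.pt from cY.ι.app j) ≫ i := by
  have h := cG.ι.app j ≫= sq.w
  rw [← Category.assoc, ← Category.assoc, hG.fac, hG.fac] at h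
  exact h.trans (Category.assoc _ _ _)

variable (sq : IsPushout (hG.desc (G.mapCocone cX))
    (hG.desc ((Cocone.precompose (Functor.whiskerLeft D (strNatTrans G))).obj cY)) t i)

/-- The cocone of pre-algebras obtained by extending the codomain along the comparison
`colim G X ⟶ G (colim X)`. -/
def coconeOfIsPushout : Cocone D where
  pt :=
    { src := cX.pt
      tgt := Z
      unit := hX.desc ((Cocone.precompose (Functor.whiskerLeft D (unitNatTrans G))).obj cY) ≫ i
      str := t }
  ι :=
    { app j :=
        { src := cX.ι.app j
          tgt := (show (D.obj j).tgt ⟶ cY.pt from cY.ι.app j) ≫ i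
          unit_tgt := (Category.assoc _ _ _).symm.trans (((hX.fac ((Cocone.precompose
            (Functor.whiskerLeft D (unitNatTrans G))).obj cY) j) =≫ i).symm.trans
              (Category.assoc _ _ _))
          str_tgt := (map_ι_comp hG sq j).symm }
      naturality j k f := by
        apply hom_ext
        · exact cX.ι.naturality f
        · exact (cY.w_assoc f i).trans (Category.comp_id _).symm }

/-- The colimits of carriers and of codomains induce `dX` and `dY`. Compatibility with the structure
maps need only hold on `colim G X`, and the pushout extends it to `G (colim X)`. -/
theorem existsUnique_desc (hY : IsColimit cY) (s : Cocone D) :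
    ∃! l : (coconeOfIsPushout hX hG sq).pt ⟶ s.pt,
      ∀ j, (coconeOfIsPushout hX hG sq).ι.app j ≫ l = s.ι.app j := by
  let dX : cX.pt ⟶ s.pt.src := hX.desc ((srcFunctor G).mapCocone s)
  let dY : cY.pt ⟶ s.pt.tgt := hY.desc ((tgtFunctor G).mapCocone s)
  have hdX (j : J) : cX.ι.app j ≫ dX = (s.ι.app j).src := hX.fac _ j
  have hdY (j : J) : cY.ι.app j ≫ dY = (s.ι.app j).tgt := hY.fac _ j
  have w : hG.desc (G.mapCocone cX) ≫ G.map dX ≫ s.pt.str =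
      hG.desc ((Cocone.precompose (Functor.whiskerLeft D (strNatTrans G))).obj cY) ≫ dY := by
    refine hG.hom_ext fun j => ?_
    refine (hG.fac_assoc _ _ _).trans (Eq.trans ?_ (hG.fac_assoc _ _ _).symm)
    have h : G.map (cX.ι.app j) ≫ G.map dX ≫ s.pt.str = G.map (cX.ι.app j ≫ dX) ≫ s.pt.str := by
      rw [G.map_comp, Category.assoc]
    exact h.trans ((congrArg G.map (hdX j) =≫ _).trans ((s.ι.app j).str_tgt.symm.trans
      (((D.obj j).str ≫= (hdY j).symm).trans (Category.assoc _ _ _).symm)))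
  refine ⟨⟨dX, sq.desc _ _ w, ?_, sq.inl_desc _ _ w⟩, fun j => ?_, fun l hl => ?_⟩
  · refine hX.hom_ext fun j => ?_
    have h : _ = (D.obj j).unit ≫ (show (D.obj j).tgt ⟶ cY.pt from cY.ι.app j) :=
      hX.fac ((Cocone.precompose (Functor.whiskerLeft D (unitNatTrans G))).obj cY) j
    have h' : cX.ι.app j ≫
        (hX.desc ((Cocone.precompose (Functor.whiskerLeft D (unitNatTrans G))).obj cY) ≫ i) ≫
          sq.desc _ _ w =
        (D.obj j).unit ≫ (show (D.obj j).tgt ⟶ cY.pt from cY.ι.app j) ≫ dY := by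
      rw [Category.assoc, sq.inr_desc, ← Category.assoc]
      exact (h =≫ dY).trans (Category.assoc _ _ _)
    exact h'.trans (((D.obj j).unit ≫= hdY j).trans ((s.ι.app j).unit_tgt.trans
      (((hdX j).symm =≫ _).trans (Category.assoc _ _ _))))
  · apply hom_ext
    · exact hdX j
    · calc ((show (D.obj j).tgt ⟶ cY.pt from cY.ι.app j) ≫ i) ≫ sq.desc _ _ w
        _ = (show (D.obj j).tgt ⟶ cY.pt from cY.ι.app j) ≫ dY := by
          rw [Category.assoc, sq.inr_desc]
        _ = _ := hdY j
  · have hsrc : l.src = dX := hX.hom_ext fun j =>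
      (congrArg Hom.src (hl j)).trans (hdX j).symm
    apply hom_ext
    · exact hsrc
    · refine sq.hom_ext (l.str_tgt.trans ?_) ?_
      · rw [hsrc]
        exact (sq.inl_desc _ _ w).symm
      · refine Eq.trans (hY.hom_ext fun j => ?_) (sq.inr_desc _ _ w).symm
        exact ((Category.assoc _ _ _).symm.trans (congrArg Hom.tgt (hl j))).trans (hdY j).symm

/-- The cocone `coconeOfIsPushout` is a colimit. -/
noncomputable def isColimitCoconeOfIsPushout (hY : IsColimit cY) :
    IsColimit (coconeOfIsPushout hX hG sq) :=
  IsColimit.ofExistsUnique (existsUnique_desc hX hG sq hY)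

end Colimits

theorem hasColimitsOfShape (J : Type*) [Category* J] [HasColimitsOfShape J C] [HasPushouts C] :
    HasColimitsOfShape J (PreAlgebra G) where
  has_colimit D := ⟨⟨⟨_, isColimitCoconeOfIsPushout (colimit.isColimit (D ⋙ srcFunctor G))
    (colimit.isColimit ((D ⋙ srcFunctor G) ⋙ G)) (IsPushout.of_hasPushout _ _)
    (colimit.isColimit (D ⋙ tgtFunctor G))⟩⟩⟩

/-- If `G` preserves colimits of a given shape, these are computed on carriers and codomains. -/
theorem exists_isColimit (J : Type*) [Category* J] [HasColimitsOfShape J C]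
    [PreservesColimitsOfShape J G] (D : J ⥤ PreAlgebra G) :
    ∃ (c : Cocone D) (_ : IsColimit c), Nonempty (IsColimit ((srcFunctor G).mapCocone c)) ∧
      Nonempty (IsColimit ((tgtFunctor G).mapCocone c)) := by
  let hX := colimit.isColimit (D ⋙ srcFunctor G)
  let hY := colimit.isColimit (D ⋙ tgtFunctor G)
  let hG := isColimitOfPreserves G hX
  have : IsIso (hG.desc (G.mapCocone (colimit.cocone (D ⋙ srcFunctor G)))) := by
    rw [hG.desc_self]
    infer_instance
  let t := hG.desc ((Cocone.precompose (Functor.whiskerLeft D (strNatTrans G))).obj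
    (colimit.cocone (D ⋙ tgtFunctor G)))
  -- The comparison `colim G X ⟶ G (colim X)` is invertible here, so pushing out along it leaves the
  -- colimit of codomains unchanged.
  have sq : IsPushout (hG.desc (G.mapCocone (colimit.cocone (D ⋙ srcFunctor G)))) t t
      (𝟙 (colimit.cocone (D ⋙ tgtFunctor G)).pt) :=
    have : IsIso (𝟙 (colimit.cocone (D ⋙ tgtFunctor G)).pt) := IsIso.id _
    IsPushout.of_horiz_isIso ⟨by rw [hG.desc_self]; simp⟩
  refine ⟨_, isColimitCoconeOfIsPushout hX hG sq hY, ⟨IsColimit.ofIsoColimit hX ?_⟩,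
    ⟨IsColimit.ofIsoColimit hY ?_⟩⟩
  · exact Cocone.ext (Iso.refl _) (fun j => Category.comp_id _)
  · exact Cocone.ext (Iso.refl _) (fun j => rfl)

/-! ### Accessibility of carrier and codomain -/

section Accessible

variable (κ : Cardinal.{w}) [Fact κ.IsRegular] [HasColimitsOfSize.{w, w} C]
  [G.IsCardinalAccessible κ]

instance isCardinalAccessible_srcFunctor : (srcFunctor G).IsCardinalAccessible κ where
  preservesColimitOfShape J _ _ :=
    { preservesColimit {D} := by
        have := G.preservesColimitsOfShape_of_isCardinalAccessible κ J
        obtain ⟨c, hc, ⟨h⟩, -⟩ := exists_isColimit J D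
        exact preservesColimit_of_preserves_colimit_cocone hc h }

instance isCardinalAccessible_tgtFunctor : (tgtFunctor G).IsCardinalAccessible κ where
  preservesColimitOfShape J _ _ :=
    { preservesColimit {D} := by
        have := G.preservesColimitsOfShape_of_isCardinalAccessible κ J
        obtain ⟨c, hc, -, ⟨h⟩⟩ := exists_isColimit J D
        exact preservesColimit_of_preserves_colimit_cocone hc h }

end Accessible

/-! ### Free pre-algebras -/

section Free

variable [HasBinaryCoproducts C]

variable (G) in
/-- The free pre-algebra on a carrier. -/
noncomputable def freeSrc (P : C) : PreAlgebra G :=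
  ⟨P, P ⨿ G.obj P, coprod.inl, coprod.inr⟩

/-- Morphisms out of `freeSrc G P` are determined by their action on carriers. -/
noncomputable def freeSrcEquiv (P : C) (S : PreAlgebra G) : (freeSrc G P ⟶ S) ≃ (P ⟶ S.src) where
  toFun f := f.src
  invFun g := ⟨g, coprod.desc (g ≫ S.unit) (G.map g ≫ S.str),
    coprod.inl_desc _ _, coprod.inr_desc _ _⟩
  left_inv f := hom_ext rfl (coprod.hom_ext
    ((coprod.inl_desc _ _).trans f.unit_tgt.symm) ((coprod.inr_desc _ _).trans f.str_tgt.symm))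
  right_inv _ := rfl

theorem isRightAdjoint_srcFunctor : (srcFunctor G).IsRightAdjoint := by
  rw [Functor.isRightAdjoint_iff_leftAdjointObjIsDefined_eq_top]
  ext P
  have r : (srcFunctor G ⋙ coyoneda.obj (op P)).CorepresentableBy (freeSrc G P) :=
    { homEquiv {S} := freeSrcEquiv P S
      homEquiv_comp _ _ := rfl }
  simpa using! r.isCorepresentable

variable [HasInitial C]

variable (G) in
/-- The free pre-algebra on an object of values. -/
noncomputable def freeTgt (P : C) : PreAlgebra G :=
  ⟨⊥_ C, P ⨿ G.obj (⊥_ C), initial.to _, coprod.inr⟩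

/-- Morphisms out of `freeTgt G P` are determined by their restriction to `P`. -/
noncomputable def freeTgtEquiv (P : C) (S : PreAlgebra G) : (freeTgt G P ⟶ S) ≃ (P ⟶ S.tgt) where
  toFun f := (show P ⟶ (freeTgt G P).tgt from coprod.inl) ≫ f.tgt
  invFun g := ⟨initial.to _, coprod.desc g (G.map (initial.to _) ≫ S.str),
    initialIsInitial.hom_ext _ _, coprod.inr_desc _ _⟩
  left_inv f := by
    have h : f.src = initial.to _ := initialIsInitial.hom_ext _ _
    refine hom_ext h.symm (coprod.hom_ext (coprod.inl_desc _ _) ((coprod.inr_desc _ _).trans ?_))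
    rw [← h]
    exact f.str_tgt.symm
  right_inv g := coprod.inl_desc _ _

theorem isRightAdjoint_tgtFunctor : (tgtFunctor G).IsRightAdjoint := by
  rw [Functor.isRightAdjoint_iff_leftAdjointObjIsDefined_eq_top]
  ext P
  have r : (tgtFunctor G ⋙ coyoneda.obj (op P)).CorepresentableBy (freeTgt G P) :=
    { homEquiv {S} := freeTgtEquiv P S
      homEquiv_comp _ _ := (Category.assoc _ _ _).symm }
  simpa using! r.isCorepresentable

end Free

/-! ### Algebras as an orthogonality class -/

section Comparison

variable [(srcFunctor G).IsRightAdjoint] [(tgtFunctor G).IsRightAdjoint]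

variable (G) in
/-- The natural transformation between free pre-algebras that is conjugate to the comparison
morphisms. -/
noncomputable def comparison : (tgtFunctor G).leftAdjoint ⟶ (srcFunctor G).leftAdjoint :=
  (conjugateEquiv (Adjunction.ofIsRightAdjoint (srcFunctor G))
    (Adjunction.ofIsRightAdjoint (tgtFunctor G))).symm (unitNatTrans G)

/-- Under the two adjunctions, precomposing with `comparison G` becomes postcomposing with the
comparison morphism of `S`; this turns orthogonality into a condition on `S.unit`. -/
theorem homEquiv_comparison (P : C) (S : PreAlgebra G)
    (g : (srcFunctor G).leftAdjoint.obj P ⟶ S) :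
    (Adjunction.ofIsRightAdjoint (tgtFunctor G)).homEquiv P S ((comparison G).app P ≫ g) =
      (Adjunction.ofIsRightAdjoint (srcFunctor G)).homEquiv P S g ≫ S.unit := by
  have h := unit_conjugateEquiv_symm (Adjunction.ofIsRightAdjoint (srcFunctor G))
    (Adjunction.ofIsRightAdjoint (tgtFunctor G)) (unitNatTrans G) P
  rw [Adjunction.homEquiv_unit, Adjunction.homEquiv_unit, Functor.map_comp, ← Category.assoc]
  refine (h =≫ _).symm.trans ?_
  refine (Category.assoc _ _ _).trans (Eq.trans ?_ (Category.assoc _ _ _).symm)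
  exact _ ≫= ((unitNatTrans G).naturality g).symm

/-- The components of `comparison G` at the objects satisfying `P`. -/
def comparisonProperty (P : ObjectProperty C) : MorphismProperty (PreAlgebra G) :=
  MorphismProperty.ofHoms fun p : Subtype P => (comparison G).app p.1

theorem isLocal_comparisonProperty_iff {P : ObjectProperty C} (hP : P.IsStrongGenerator)
    (S : PreAlgebra G) : (comparisonProperty (G := G) P).isLocal S ↔ IsIso S.unit := by
  have key (p : C) : Function.Bijective (fun g : _ ⟶ S => (comparison G).app p ≫ g) ↔
      Function.Bijective (fun f : p ⟶ S.src => f ≫ S.unit) := by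
    let e := (Adjunction.ofIsRightAdjoint (srcFunctor G)).homEquiv p S
    let e' := (Adjunction.ofIsRightAdjoint (tgtFunctor G)).homEquiv p S
    refine (Equiv.comp_bijective _ e').symm.trans (Iff.trans ?_ (Equiv.bijective_comp e _))
    exact iff_of_eq (congrArg _ (funext fun g => homEquiv_comparison p S g))
  constructor
  · intro h
    have h' (p : C) (hp : P p) : Function.Bijective (fun f : p ⟶ S.src => f ≫ S.unit) :=
      (key p).1 (h _ (MorphismProperty.ofHoms.mk (⟨p, hp⟩ : Subtype P)))
    -- Injectivity on maps from the generator gives a monomorphism; surjectivity then makes it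
    -- invertible, as the generator is strong.
    have : Mono S.unit := by
      rw [hP.isSeparating.mono_iff]
      exact fun p hp _ _ e => (h' p hp).1 e
    exact hP.isIso_of_mono _ fun p hp => (h' p hp).2
  · rintro _ _ _ _ ⟨p⟩
    refine (key p.1).2 ⟨fun f g e => ?_, fun f => ⟨f ≫ inv S.unit, by simp⟩⟩
    exact (cancel_mono S.unit).1 e

end Comparison

/-! ### Reflecting pre-algebras into algebras -/

/-- Algebras as pre-algebras with trivial comparison morphism. -/
def ofAlgebra (G : C ⥤ C) : Endofunctor.Algebra G ⥤ PreAlgebra G where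
  obj B := ⟨B.a, B.a, 𝟙 _, B.str⟩
  map f := ⟨f.f, f.f, by simp, f.h.symm⟩

instance : (ofAlgebra G).Faithful where
  map_injective h := Endofunctor.Algebra.ext (congrArg Hom.src h)

theorem src_eq_tgt {R : PreAlgebra G} {B : Endofunctor.Algebra G}
    (f : R ⟶ (ofAlgebra G).obj B) : f.src = R.unit ≫ f.tgt :=
  (f.unit_tgt.trans (Category.comp_id _)).symm

instance : (ofAlgebra G).Full where
  map_surjective {A B} f := by
    have h : f.src = f.tgt := (src_eq_tgt f).trans (Category.id_comp _)
    refine ⟨⟨f.src, ?_⟩, hom_ext rfl h⟩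
    exact f.str_tgt.symm.trans (A.str ≫= h.symm)

theorem essImage_ofAlgebra (S : PreAlgebra G) (hS : IsIso S.unit) : (ofAlgebra G).essImage S := by
  obtain ⟨i, hi, hi'⟩ := hS
  exact ⟨⟨S.src, S.str ≫ i⟩, ⟨{
    hom := ⟨𝟙 S.src, S.unit, rfl, (Category.assoc _ _ _).trans
      ((S.str ≫= hi').trans ((Category.comp_id _).trans
        ((G.map_id _ =≫ _).trans (Category.id_comp _)).symm))⟩
    inv := ⟨𝟙 S.src, i, hi.trans (Category.id_comp _).symm,
      ((G.map_id _ =≫ _).trans (Category.id_comp _)).symm⟩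
    hom_inv_id := hom_ext (Category.comp_id _) hi
    inv_hom_id := hom_ext (Category.comp_id _) hi' }⟩⟩

theorem isRightAdjoint_ofAlgebra (κ : Cardinal.{w}) [Fact κ.IsRegular]
    [IsCardinalLocallyPresentable C κ] [G.IsCardinalAccessible κ] :
    (ofAlgebra G).IsRightAdjoint := by
  have := locallySmall.{w} (G := G)
  have : HasColimitsOfSize.{w, w} (PreAlgebra G) := ⟨fun J _ => hasColimitsOfShape J⟩
  have := isRightAdjoint_srcFunctor (G := G)
  have := isRightAdjoint_tgtFunctor (G := G)
  obtain ⟨P, _, hP⟩ := HasCardinalFilteredGenerator.exists_small_generator C κ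
  let W := comparisonProperty (G := G) P
  have : MorphismProperty.IsSmall.{w} W := by dsimp [W, comparisonProperty]; infer_instance
  -- A left adjoint of a `κ`-accessible functor preserves `κ`-presentable objects.
  have hW ⦃X Y : PreAlgebra G⦄ (f : X ⟶ Y) (hf : W f) :
      IsCardinalPresentable X κ ∧ IsCardinalPresentable Y κ := by
    obtain ⟨p⟩ := hf
    have : IsCardinalPresentable p.1 κ := hP.le_isCardinalPresentable _ p.2
    exact ⟨(Adjunction.ofIsRightAdjoint (tgtFunctor G)).isCardinalPresentable_leftAdjoint_obj κ _,
      (Adjunction.ofIsRightAdjoint (srcFunctor G)).isCardinalPresentable_leftAdjoint_obj κ _⟩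
  have := W.isRightAdjoint_ι_isLocal κ hW
  have hlocal (S : PreAlgebra G) : W.isLocal S ↔ IsIso S.unit :=
    isLocal_comparisonProperty_iff hP.isStrongGenerator S
  -- Algebras are equivalent to the `W`-local pre-algebras, so they inherit the reflection.
  let K : Endofunctor.Algebra G ⥤ W.isLocal.FullSubcategory :=
    W.isLocal.lift (ofAlgebra G) fun B => (hlocal _).2 (inferInstanceAs (IsIso (𝟙 B.a)))
  have : K.EssSurj := ⟨fun S => by
    obtain ⟨B, ⟨e⟩⟩ := essImage_ofAlgebra S.obj ((hlocal _).1 S.property)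
    exact ⟨B, ⟨W.isLocal.isoMk e⟩⟩⟩
  have : K.IsEquivalence := {}
  exact inferInstanceAs (K ⋙ W.isLocal.ι).IsRightAdjoint

/-! ### The left adjoint of reindexing -/

section Reindexing

variable [HasPushouts C] {F : C ⥤ C} (α : F ⟶ G)

/-- The pre-algebra freely generated by an `F`-algebra along `α : F ⟶ G`. -/
noncomputable def extend (A : Endofunctor.Algebra F) : PreAlgebra G :=
  ⟨A.a, pushout A.str (α.app A.a), pushout.inl _ _, pushout.inr _ _⟩

/-- Morphisms from `extend α A` to a `G`-algebra are the `F`-algebra morphisms from `A` to its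
reindexing along `α`. -/
noncomputable def extendEquiv (A : Endofunctor.Algebra F) (B : Endofunctor.Algebra G) :
    (extend α A ⟶ (ofAlgebra G).obj B) ≃
      (A ⟶ (Endofunctor.Algebra.functorOfNatTrans α).obj B) where
  toFun f :=
    { f := f.src
      h := by
        have hu : f.src = pushout.inl A.str (α.app A.a) ≫ f.tgt := src_eq_tgt f
        have hs : G.map f.src ≫ B.str = pushout.inr A.str (α.app A.a) ≫ f.tgt :=
          f.str_tgt.symm
        have hα : F.map f.src ≫ α.app B.a ≫ B.str = α.app A.a ≫ G.map f.src ≫ B.str :=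
          α.naturality_assoc _ _
        exact hα.trans ((α.app A.a ≫= hs).trans ((pushout.condition_assoc _).symm.trans
          (A.str ≫= hu.symm))) }
  invFun g := ⟨g.f, pushout.desc g.f (G.map g.f ≫ B.str)
    (g.h.symm.trans (α.naturality_assoc g.f B.str)),
    (pushout.inl_desc _ _ _).trans (Category.comp_id _).symm, pushout.inr_desc _ _ _⟩
  left_inv f := hom_ext rfl (pushout.hom_ext
    ((pushout.inl_desc _ _ _).trans (src_eq_tgt f))
      ((pushout.inr_desc _ _ _).trans f.str_tgt.symm))
  right_inv _ := rfl

end Reindexing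

end PreAlgebra

theorem isRightAdjoint_functorOfNatTrans {C : Type u} [Category.{v} C] (κ : Cardinal.{w})
    [Fact κ.IsRegular] [IsCardinalLocallyPresentable C κ] {F G : C ⥤ C}
    [G.IsCardinalAccessible κ] (α : F ⟶ G) :
    (Endofunctor.Algebra.functorOfNatTrans α).IsRightAdjoint := by
  have := PreAlgebra.isRightAdjoint_ofAlgebra (G := G) κ
  let adj := Adjunction.ofIsRightAdjoint (PreAlgebra.ofAlgebra G)
  rw [Functor.isRightAdjoint_iff_leftAdjointObjIsDefined_eq_top]
  ext A
  have r : (Endofunctor.Algebra.functorOfNatTrans α ⋙ coyoneda.obj (op A)).CorepresentableBy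
      ((PreAlgebra.ofAlgebra G).leftAdjoint.obj (PreAlgebra.extend α A)) :=
    { homEquiv {B} := (adj.homEquiv _ _).trans (PreAlgebra.extendEquiv α A B)
      homEquiv_comp f g := by
        apply Endofunctor.Algebra.ext
        exact congrArg PreAlgebra.Hom.src (adj.homEquiv_naturality_right g f) }
  simpa using! r.isCorepresentable

theorem mainTheorem7 {X : Type u} [Category.{v} X] (κ : Cardinal.{w}) [Fact κ.IsRegular]
    [IsCardinalLocallyPresentable X κ]
    {F G : (accessibleEndo X κ).FullSubcategory} (α : F ⟶ G) :
    (algReindexing α).IsRightAdjoint := by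
  have : G.obj.IsCardinalAccessible κ := G.property
  exact isRightAdjoint_functorOfNatTrans κ α.hom
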